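/- Let $d,N\in\mathbb N$ with $N\ge 1$, $T>0$, $\varepsilon>0$, and let $\mathbb T^d=\mathbb R^d/2\pi\mathbb Z^d$ with normalized Lebesgue measure $\mathrm{Leb}$. Let $\Omega=C([0,T],\mathbb T^d)$ carry the topology of uniform convergence, with evaluation maps $e_t(\omega)=\omega(t)$, and let $P_N:\Omega\to(\mathbb T^d)^{N+1}$, $P_N(\omega)=(\omega(kT/N))_{k=0,\dots,N}$. For probability measures $q,r$ on a Polish space, let $H(q\mid r)=\int\log\frac{dq}{dr}\,dq$ if $q\ll r$ and $H(q\mid r)=+\infty$ otherwise. Let $\pi_{0,T}$ be a probability measure on $\mathbb T^d\times\mathbb T^d$ with both marginals equal to $\mathrm{Leb}$ and $H(\pi_{0,T}\mid\mathrm{Leb}\otimes\mathrm{Leb})<+\infty$. Set $$\mathrm{GIF}_N(\pi_{0,T})=\{Q\in\mathcal P(\Omega): (e_{kT/N})_\#Q=\mathrm{Leb}\ (k=0,\dots,N),\ (e_0,e_T)_\#Q=\pi_{0,T}\},$$ $$\Gamma_N(\pi_{0,T})=\{\gamma\in\mathcal P((\mathbb T^d)^{N+1}): (\mathrm{proj}_k)_\#\gamma=\mathrm{Leb}\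 (k=0,\dots,N),\ (\mathrm{proj}_{0,N})_\#\gamma=\pi_{0,T}\},$$ where $\mathrm{proj}_k(x_0,\dots,x_N)=x_k$ and $\mathrm{proj}_{0,N}(x_0,\dots,x_N)=(x_0,x_N)$. Let $R_\varepsilon\in\mathcal P(\Omega)$ be the law of $t\mapsto x+\sqrt\varepsilon B_t$ modulo $2\pi\mathbb Z^d$, where $x$ has law $\mathrm{Leb}$ and $B$ is a standard Brownian motion of $\mathbb R^d$ on $[0,T]$ started at $0$ and independent of $x$. Let $\theta_{N,\varepsilon}=(P_N)_\#R_\varepsilon$, and let $(R_\varepsilon^{\mathbf x})_{\mathbf x\in(\mathbb T^d)^{N+1}}$ be a regular conditional law of $\omega$ under $R_\varepsilon$ given $P_N(\omega)=\mathbf x$ (a family of Brownian bridges), so that $R_\varepsilon=\int R_\varepsilon^{\mathbf x}\,d\theta_{N,\varepsilon}(\mathbf x)$. Let $Q^\star\in\mathrm{GIF}_N(\pi_{0,T})$ and $\gamma^\star=(P_N)_\#Q^\star$. Then $Q^\star$ solves $$\inf_{Q\in\mathrm{GIF}_N(\pi_{0,T})}H(Q\mid R_\varepsilon)$$ if and only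 if both of the following hold: $\gamma^\star$ solves $$\inf_{\gamma\in\Gamma_N(\pi_{0,T})}H(\gamma\mid\theta_{N,\varepsilon}),$$ and $$Q^\star=\int_{(\mathbb T^d)^{N+1}}R_\varepsilon^{\mathbf x}\,d\gamma^\star(\mathbf x).$$ -/

import Mathlib

open MeasureTheory ProbabilityTheory Filter Topology
open scoped NNReal ENNReal

namespace Bredinger

/-! ### Wiener measure

Wiener measure on `C([0, T], ℝ)` is built as the law of the uniformly convergent random series
`∑ ξ_{n,k} e_{n,k}`, with independent standard Gaussian coefficients `ξ_{n,k}` and the Schauder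
functions `e_{n,k}`. That it is the law of Brownian motion is `wienerMeasure_map_restrict`. -/

/-- The tent function on `[0, 1]`. -/
noncomputable def tent (x : ℝ) : ℝ := max 0 (1 / 2 - |x - 1 / 2|)

lemma tent_nonneg (x : ℝ) : 0 ≤ tent x := le_max_left _ _

lemma tent_le_one (x : ℝ) : tent x ≤ 1 := by
  unfold tent
  have := abs_nonneg (x - 1 / 2)
  exact max_le (by norm_num) (by linarith)

lemma tent_of_nonpos {x : ℝ} (h : x ≤ 0) : tent x = 0 := by
  unfold tent
  rw [abs_of_nonpos (by linarith)]
  exact max_eq_left (by linarith)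

lemma tent_of_one_le {x : ℝ} (h : 1 ≤ x) : tent x = 0 := by
  unfold tent
  rw [abs_of_nonneg (by linarith)]
  exact max_eq_left (by linarith)

lemma tent_left {x : ℝ} (h0 : 0 ≤ x) (h : x ≤ 1 / 2) : tent x = x := by
  unfold tent
  rw [abs_of_nonpos (by linarith), max_eq_right] <;> linarith

lemma tent_right {x : ℝ} (h0 : 1 / 2 ≤ x) (h : x ≤ 1) : tent x = 1 - x := by
  unfold tent
  rw [abs_of_nonneg (by linarith), max_eq_right] <;> linarith

@[fun_prop]
lemma continuous_tent : Continuous tent := by unfold tent; fun_prop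

lemma pow_four_sum_tent_le (n : ℕ) (a : ℕ → ℝ) (x : ℝ) :
    (∑ k ∈ Finset.range n, a k * tent (x - k)) ^ 4 ≤ ∑ k ∈ Finset.range n, a k ^ 4 := by
  have hnn : ∀ k ∈ Finset.range n, 0 ≤ a k ^ 4 := fun k _ => by positivity
  by_cases h : ∃ k ∈ Finset.range n, tent (x - k) ≠ 0
  · obtain ⟨k, hk, hne⟩ := h
    have h1 : (k : ℝ) < x := by
      by_contra hc
      exact hne (tent_of_nonpos (by linarith))
    have h2 : x < k + 1 := by
      by_contra hc
      exact hne (tent_of_one_le (by linarith))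
    rw [Finset.sum_eq_single k]
    · refine le_trans ?_ (Finset.single_le_sum hnn hk)
      rw [mul_pow]
      have := pow_le_one₀ (n := 4) (tent_nonneg (x - k)) (tent_le_one _)
      nlinarith [show 0 ≤ a k ^ 4 by positivity]
    · intro j _ hj
      rcases lt_or_gt_of_ne hj with hlt | hlt
      · have : (j : ℝ) + 1 ≤ k := by exact_mod_cast hlt
        rw [tent_of_one_le (by linarith), mul_zero]
      · have : (k : ℝ) + 1 ≤ j := by exact_mod_cast hlt
        rw [tent_of_nonpos (by linarith), mul_zero]
    · intro h
      exact absurd hk h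
  · push Not at h
    rw [Finset.sum_eq_zero (fun k hk => by rw [h k hk, mul_zero])]
    simpa using Finset.sum_nonneg hnn

/-- The covariance of the `n`-th level of the random series. -/
noncomputable def tentKer (n : ℕ) (s t : ℝ) : ℝ :=
  ∑ k ∈ Finset.range (2 ^ n), (2 ^ n : ℝ)⁻¹ * (tent (2 ^ n * s - k) * tent (2 ^ n * t - k))

lemma tentKer_zero (s t : ℝ) : tentKer 0 s t = tent s * tent t := by simp [tentKer]

lemma tentKer_succ (n : ℕ) (s t : ℝ) : tentKer (n + 1) s t =
    (tentKer n (2 * s) (2 * t) + tentKer n (2 * s - 1) (2 * t - 1)) / 2 := by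
  unfold tentKer
  rw [pow_succ, mul_two, Finset.sum_range_add, add_div, Finset.sum_div, Finset.sum_div]
  congr 1 <;> refine Finset.sum_congr rfl fun k _ => ?_
  · rw [show (2 : ℝ) ^ (n + 1) * s - k = 2 ^ n * (2 * s) - k by ring,
      show (2 : ℝ) ^ (n + 1) * t - k = 2 ^ n * (2 * t) - k by ring]
    field_simp
    ring
  · rw [show (2 : ℝ) ^ (n + 1) * s - (2 ^ n + k : ℕ) = 2 ^ n * (2 * s - 1) - k by push_cast; ring,
      show (2 : ℝ) ^ (n + 1) * t - (2 ^ n + k : ℕ) = 2 ^ n * (2 * t - 1) - k by push_cast; ring]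
    field_simp
    ring

lemma tentKer_comm (n : ℕ) (s t : ℝ) : tentKer n s t = tentKer n t s := by
  unfold tentKer
  exact Finset.sum_congr rfl fun k _ => by ring

lemma tentKer_of_nonpos (n : ℕ) {s : ℝ} (t : ℝ) (h : s ≤ 0) : tentKer n s t = 0 := by
  unfold tentKer
  refine Finset.sum_eq_zero fun k _ => ?_
  have : (2 : ℝ) ^ n * s ≤ 0 := mul_nonpos_of_nonneg_of_nonpos (by positivity) h
  rw [tent_of_nonpos (by linarith [k.cast_nonneg (α := ℝ)])]
  ring

lemma tentKer_of_one_le (n : ℕ) {s : ℝ} (t : ℝ) (h : 1 ≤ s) : tentKer n s t = 0 := by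
  unfold tentKer
  refine Finset.sum_eq_zero fun k hk => ?_
  have h1 : (2 : ℝ) ^ n * 1 ≤ 2 ^ n * s := by gcongr
  have h2 : (k : ℝ) + 1 ≤ 2 ^ n := by exact_mod_cast Finset.mem_range.1 hk
  rw [tent_of_one_le (by linarith)]
  ring

lemma tentKer_approx (m : ℕ) : ∀ {s t : ℝ}, 0 ≤ s → s ≤ 1 → 0 ≤ t → t ≤ 1 →
    |min s t - s * t - ∑ n ∈ Finset.range m, tentKer n s t| ≤ (1 / 2) ^ m := by
  induction m with
  | zero =>
    intro s t hs0 hs1 ht0 ht1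
    simp only [Finset.range_zero, Finset.sum_empty, sub_zero, pow_zero]
    rw [abs_le]
    rcases le_total s t with h | h
    · rw [min_eq_left h]; constructor <;> nlinarith
    · rw [min_eq_right h]; constructor <;> nlinarith
  | succ m ih =>
    intro s t hs0 hs1 ht0 ht1
    wlog hst : s ≤ t generalizing s t
    · have := this ht0 ht1 hs0 hs1 (by linarith)
      rw [min_comm, mul_comm s t]
      simpa only [tentKer_comm] using this
    rw [Finset.sum_range_succ', tentKer_zero]
    simp only [tentKer_succ]
    rw [← Finset.sum_div, Finset.sum_add_distrib, min_eq_left hst]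
    rcases le_total t (1 / 2) with ht | ht
    · have e : ∑ n ∈ Finset.range m, tentKer n (2 * s - 1) (2 * t - 1) = 0 :=
        Finset.sum_eq_zero fun n _ => tentKer_of_nonpos _ _ (by linarith)
      have := ih (s := 2 * s) (t := 2 * t) (by linarith) (by linarith) (by linarith) (by linarith)
      rw [min_eq_left (by linarith)] at this
      rw [e, tent_left hs0 (by linarith), tent_left ht0 ht, pow_succ]
      rw [abs_le] at this ⊢
      constructor <;> nlinarith
    rcases le_total s (1 / 2) with hs | hs
    · have e : ∑ n ∈ Finset.range m, tentKer n (2 * s - 1) (2 * t - 1) = 0 :=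
        Finset.sum_eq_zero fun n _ => tentKer_of_nonpos _ _ (by linarith)
      have e' : ∑ n ∈ Finset.range m, tentKer n (2 * s) (2 * t) = 0 :=
        Finset.sum_eq_zero fun n _ => by rw [tentKer_comm]; exact tentKer_of_one_le _ _ (by linarith)
      rw [e, e', tent_left hs0 hs, tent_right ht ht1]
      rw [show s - s * t - ((0 + 0) / 2 + s * (1 - t)) = 0 by ring, abs_zero]
      positivity
    · have e : ∑ n ∈ Finset.range m, tentKer n (2 * s) (2 * t) = 0 :=
        Finset.sum_eq_zero fun n _ => tentKer_of_one_le _ _ (by linarith)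
      have := ih (s := 2 * s - 1) (t := 2 * t - 1)
        (by linarith) (by linarith) (by linarith) (by linarith)
      rw [min_eq_left (by linarith)] at this
      rw [e, tent_right hs hs1, tent_right ht ht1, pow_succ]
      rw [abs_le] at this ⊢
      constructor <;> nlinarith

/-- Path spaces carry the Borel `σ`-algebra of the topology of uniform convergence. -/
instance pathMeasurableSpace {X Y : Type*} [TopologicalSpace X] [TopologicalSpace Y] :
    MeasurableSpace C(X, Y) := borel _

instance pathBorelSpace {X Y : Type*} [TopologicalSpace X] [TopologicalSpace Y] :
    BorelSpace C(X, Y) := ⟨rfl⟩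

/-- The Schauder functions on `[0, 1]`; level `0` is the linear function. -/
noncomputable def schauder : ℕ → ℕ → ℝ → ℝ
  | 0, _, t => t
  | n + 1, k, t => (√(2 ^ n))⁻¹ * tent (2 ^ n * t - k)

lemma continuous_schauder (n k : ℕ) : Continuous (schauder n k) := by
  cases n
  · exact continuous_id
  · unfold schauder; fun_prop

/-- The Schauder functions, scaled to `[0, T]`. -/
noncomputable def schauderPath (T : ℝ≥0) (n k : ℕ) : C(Set.Icc (0 : ℝ≥0) T, ℝ) where
  toFun t := √T * schauder n k ((t : ℝ≥0) / T)
  continuous_toFun := by have := continuous_schauder n k; fun_prop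

abbrev Coeff : Type := (Σ _ : ℕ, ℕ) → ℝ

/-- The law of a family of independent standard Gaussian variables. -/
noncomputable def gaussianNoise : Measure Coeff := Measure.infinitePi fun _ => gaussianReal 0 1

instance : IsProbabilityMeasure gaussianNoise := by unfold gaussianNoise; infer_instance

noncomputable def levyTerm (T : ℝ≥0) (n : ℕ) (ξ : Coeff) : C(Set.Icc (0 : ℝ≥0) T, ℝ) :=
  ∑ k ∈ Finset.range (2 ^ (n - 1)), ξ ⟨n, k⟩ • schauderPath T n k

lemma measurable_levyTerm (T : ℝ≥0) (n : ℕ) : Measurable (levyTerm T n) := by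
  unfold levyTerm
  fun_prop

lemma norm_levyTerm_pow_le (T : ℝ≥0) (n : ℕ) (ξ : Coeff) : ‖levyTerm T (n + 1) ξ‖ ^ 4 ≤
    T ^ 2 * (1 / 4) ^ n * ∑ k ∈ Finset.range (2 ^ n), ξ ⟨n + 1, k⟩ ^ 4 := by
  set S := T ^ 2 * (1 / 4) ^ n * ∑ k ∈ Finset.range (2 ^ n), ξ ⟨n + 1, k⟩ ^ 4 with hS
  have hS0 : 0 ≤ S := mul_nonneg (by positivity) (Finset.sum_nonneg fun k _ => by positivity)
  have key : ∀ t, ‖levyTerm T (n + 1) ξ t‖ ^ 4 ≤ S := by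
    intro t
    have : levyTerm T (n + 1) ξ t = (√T * (√(2 ^ n))⁻¹) *
        ∑ k ∈ Finset.range (2 ^ n), ξ ⟨n + 1, k⟩ * tent (2 ^ n * ((t : ℝ≥0) / T : ℝ) - k) := by
      simp only [levyTerm, schauderPath, ContinuousMap.coe_sum, Finset.sum_apply,
        ContinuousMap.coe_smul, Pi.smul_apply, smul_eq_mul, ContinuousMap.coe_mk, schauder,
        Finset.mul_sum, Nat.add_sub_cancel]
      exact Finset.sum_congr rfl fun k _ => by ring
    rw [this, Real.norm_eq_abs, Even.pow_abs (by decide), mul_pow, hS]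
    gcongr
    · refine le_of_eq ?_
      have h1 : (√(T : ℝ)) ^ 4 = T ^ 2 := by
        rw [show (√(T : ℝ)) ^ 4 = ((√(T : ℝ)) ^ 2) ^ 2 by ring, Real.sq_sqrt T.coe_nonneg]
      have h2 : (√((2 : ℝ) ^ n)) ^ 4 = 4 ^ n := by
        rw [show (√((2 : ℝ) ^ n)) ^ 4 = ((√((2 : ℝ) ^ n)) ^ 2) ^ 2 by ring,
          Real.sq_sqrt (by positivity), ← pow_mul, mul_comm, pow_mul]
        norm_num
      rw [mul_pow, h1, inv_pow, h2]
      simp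
    · exact pow_four_sum_tent_le _ _ _
  by_contra! hc
  have h4 : (S ^ (1 / 4 : ℝ)) ^ 4 = S := by
    rw [← Real.rpow_natCast, ← Real.rpow_mul hS0]
    norm_num
  have : ‖levyTerm T (n + 1) ξ‖ ≤ S ^ (1 / 4 : ℝ) := by
    refine (ContinuousMap.norm_le _ (by positivity)).2 fun t => ?_
    refine le_of_pow_le_pow_left₀ (n := 4) (by norm_num) (by positivity) ?_
    rw [h4]
    exact key t
  have := pow_le_pow_left₀ (norm_nonneg _) this 4
  rw [h4] at this
  linarith

lemma ae_summable_levyTerm (T : ℝ≥0) :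
    ∀ᵐ ξ ∂gaussianNoise, Summable fun n => levyTerm T n ξ := by
  set c : ℝ≥0∞ := ∫⁻ x, ENNReal.ofReal (x ^ 4) ∂(gaussianReal 0 1) with hc
  have hcfin : c ≠ ∞ := by
    have h := (memLp_id_gaussianReal (μ := 0) (v := 1) 4).integrable_norm_pow (by norm_num)
    have h' : Integrable (fun x : ℝ => x ^ 4) (gaussianReal 0 1) := by
      refine h.congr (ae_of_all _ fun x => ?_)
      simp [Even.pow_abs (show Even 4 by decide)]
    rw [hc, ← ofReal_integral_eq_lintegral_ofReal h' (ae_of_all _ fun x => by positivity)]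
    exact ENNReal.ofReal_ne_top
  have hcoord : ∀ p, ∫⁻ ξ, ENNReal.ofReal (ξ p ^ 4) ∂gaussianNoise = c := by
    intro p
    have := (measurePreserving_eval_infinitePi (fun _ : (Σ _ : ℕ, ℕ) => gaussianReal 0 1) p)
    exact this.lintegral_comp (f := fun x => ENNReal.ofReal (x ^ 4)) (by fun_prop)
  set F : ℕ → Coeff → ℝ≥0∞ := fun n ξ => ∑ k ∈ Finset.range (2 ^ n),
    ENNReal.ofReal (((10 / 9) ^ 4 / 4) ^ n) * ENNReal.ofReal (ξ ⟨n + 1, k⟩ ^ 4) with hF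
  have hFm : ∀ n, Measurable (F n) := fun n => by fun_prop
  have hFint : ∀ n, ∫⁻ ξ, F n ξ ∂gaussianNoise = ENNReal.ofReal (((10 / 9) ^ 4 / 2) ^ n) * c := by
    intro n
    rw [hF, lintegral_finsetSum _ (by fun_prop)]
    have h1 : ∀ k ∈ Finset.range (2 ^ n), ∫⁻ ξ : Coeff, ENNReal.ofReal (((10 / 9) ^ 4 / 4) ^ n) *
        ENNReal.ofReal (ξ ⟨n + 1, k⟩ ^ 4) ∂gaussianNoise =
        ENNReal.ofReal (((10 / 9) ^ 4 / 4) ^ n) * c := fun k _ => by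
      rw [lintegral_const_mul _ (by fun_prop), hcoord]
    rw [Finset.sum_congr rfl h1, Finset.sum_const, Finset.card_range, nsmul_eq_mul, ← mul_assoc]
    congr 1
    rw [← ENNReal.ofReal_natCast, ← ENNReal.ofReal_mul (by positivity)]
    congr 1
    push_cast
    rw [← mul_pow]
    norm_num
  have hfin : ∫⁻ ξ, ∑' n, F n ξ ∂gaussianNoise ≠ ∞ := by
    rw [lintegral_tsum fun n => (hFm n).aemeasurable]
    simp_rw [hFint]
    rw [ENNReal.tsum_mul_right]
    refine ENNReal.mul_ne_top ?_ hcfin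
    rw [← ENNReal.ofReal_tsum_of_nonneg (fun n => by positivity)
      (summable_geometric_of_lt_one (by norm_num) (by norm_num))]
    exact ENNReal.ofReal_ne_top
  filter_upwards [ae_lt_top (Measurable.tsum hFm) hfin] with ξ hξ
  set C : ℝ := (∑' n, F n ξ).toReal with hC
  have hC0 : 0 ≤ C := ENNReal.toReal_nonneg
  have hbd : ∀ n, ((10 / 9 : ℝ) ^ 4 / 4) ^ n * ∑ k ∈ Finset.range (2 ^ n), ξ ⟨n + 1, k⟩ ^ 4 ≤ C := by
    intro n
    have h1 : F n ξ ≤ ∑' n, F n ξ := ENNReal.le_tsum n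
    have h2 : F n ξ = ENNReal.ofReal (((10 / 9 : ℝ) ^ 4 / 4) ^ n *
        ∑ k ∈ Finset.range (2 ^ n), ξ ⟨n + 1, k⟩ ^ 4) := by
      rw [hF, ENNReal.ofReal_mul (by positivity),
        ENNReal.ofReal_sum_of_nonneg (fun k _ => by positivity), Finset.mul_sum]
    rw [h2] at h1
    exact (ENNReal.ofReal_le_iff_le_toReal hξ.ne).1 h1
  rw [← summable_nat_add_iff 1]
  refine Summable.of_norm_bounded (g := fun n => (1 + (T : ℝ)) * (1 + C) * (9 / 10 : ℝ) ^ n)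
    ((summable_geometric_of_lt_one (by norm_num) (by norm_num)).mul_left _) fun n => ?_
  refine le_of_pow_le_pow_left₀ (n := 4) (by norm_num) (by positivity) ?_
  refine (norm_levyTerm_pow_le T n ξ).trans ?_
  have e : (1 / 4 : ℝ) ^ n = ((9 / 10) ^ n) ^ 4 * ((10 / 9 : ℝ) ^ 4 / 4) ^ n := by
    rw [← pow_mul, mul_comm n 4, pow_mul, ← mul_pow]
    norm_num
  have hT : (T : ℝ) ^ 2 ≤ (1 + T) ^ 4 := by
    have := T.coe_nonneg
    calc (T : ℝ) ^ 2 ≤ (1 + (T : ℝ)) ^ 2 := by gcongr; linarith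
      _ ≤ (1 + (T : ℝ)) ^ 4 := pow_le_pow_right₀ (by linarith) (by norm_num)
  have hC4 : C ≤ (1 + C) ^ 4 := by
    calc C ≤ (1 + C) ^ 1 := by linarith
      _ ≤ (1 + C) ^ 4 := pow_le_pow_right₀ (by linarith) (by norm_num)
  calc (T : ℝ) ^ 2 * (1 / 4) ^ n * ∑ k ∈ Finset.range (2 ^ n), ξ ⟨n + 1, k⟩ ^ 4
      = T ^ 2 * ((9 / 10) ^ n) ^ 4 * (((10 / 9 : ℝ) ^ 4 / 4) ^ n *
        ∑ k ∈ Finset.range (2 ^ n), ξ ⟨n + 1, k⟩ ^ 4) := by rw [e]; ring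
    _ ≤ (1 + T) ^ 4 * ((9 / 10) ^ n) ^ 4 * (1 + C) ^ 4 := by
        gcongr
        exact (hbd n).trans hC4
    _ = _ := by ring

noncomputable def levyIdx (m : ℕ) : Finset (Σ _ : ℕ, ℕ) :=
  (Finset.range m).sigma fun n => Finset.range (2 ^ (n - 1))

lemma integral_exp_noise (A : Finset (Σ _ : ℕ, ℕ)) (c : (Σ _ : ℕ, ℕ) → ℝ) :
    ∫ ξ, Complex.exp ((∑ p ∈ A, c p * ξ p : ℝ) * Complex.I) ∂gaussianNoise =
      Complex.exp (-(∑ p ∈ A, c p ^ 2 : ℝ) / 2) := by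
  have hind : iIndepFun (fun p (ξ : Coeff) => c p * ξ p) gaussianNoise :=
    iIndepFun_infinitePi (X := fun p x => c p * x) (fun p => by fun_prop)
  have hm : ∀ p, AEMeasurable (fun ξ : Coeff => c p * ξ p) gaussianNoise := fun p => by
    have h : Measurable fun ξ : Coeff => ξ p := measurable_pi_apply p
    exact (h.const_mul (c p)).aemeasurable
  have hm' : AEMeasurable (fun ξ : Coeff => ∑ p ∈ A, c p * ξ p) gaussianNoise :=
    Finset.aemeasurable_fun_sum _ fun p _ => hm p
  have h := congrFun (iIndepFun.charFun_map_fun_finsetSum_eq_prod (s := A)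
    (X := fun p (ξ : Coeff) => c p * ξ p) (P := gaussianNoise)
    (fun p _ => hm p) (hind.restrict A)) 1
  rw [charFun_apply_real, integral_map hm' (by fun_prop)] at h
  simp only [Complex.ofReal_one, one_mul] at h
  rw [h, Finset.prod_apply]
  have : ∀ p, charFun (gaussianNoise.map fun ξ : Coeff => c p * ξ p) 1
      = Complex.exp (-((c p ^ 2 : ℝ) : ℂ) / 2) := by
    intro p
    rw [charFun_map_mul_comp (measurable_pi_apply p).aemeasurable]
    unfold gaussianNoise
    rw [Measure.infinitePi_map_eval, charFun_gaussianReal]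
    congr 1
    push_cast
    simp
    ring
  simp_rw [this, ← Complex.exp_sum]
  congr 1
  push_cast
  rw [← Finset.sum_div, Finset.sum_neg_distrib]

noncomputable def levyCoeff (T : ℝ≥0) (p : Σ _ : ℕ, ℕ) (t : Set.Icc (0 : ℝ≥0) T) : ℝ :=
  schauderPath T p.1 p.2 t

lemma sum_levyTerm_apply (T : ℝ≥0) (m : ℕ) (ξ : Coeff) (t : Set.Icc (0 : ℝ≥0) T) :
    (∑ n ∈ Finset.range m, levyTerm T n ξ) t = ∑ p ∈ levyIdx m, levyCoeff T p t * ξ p := by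
  simp only [levyTerm, levyIdx, levyCoeff, Finset.sum_sigma, ContinuousMap.coe_sum,
    Finset.sum_apply, ContinuousMap.coe_smul, Pi.smul_apply, smul_eq_mul, mul_comm]

lemma tendsto_covariance (T : ℝ≥0) (s t : Set.Icc (0 : ℝ≥0) T) :
    Tendsto (fun m => ∑ p ∈ levyIdx m, levyCoeff T p s * levyCoeff T p t) atTop
      (𝓝 (min s.1 t.1 : ℝ≥0)) := by
  set σ : ℝ := (s : ℝ≥0) / T with hσ
  set τ : ℝ := (t : ℝ≥0) / T with hτ
  have hσ0 : 0 ≤ σ := by positivity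
  have hτ0 : 0 ≤ τ := by positivity
  have hσ1 : σ ≤ 1 := div_le_one_of_le₀ (by exact_mod_cast s.2.2) T.coe_nonneg
  have hτ1 : τ ≤ 1 := div_le_one_of_le₀ (by exact_mod_cast t.2.2) T.coe_nonneg
  have hmul : (T : ℝ) * min σ τ = (min s.1 t.1 : ℝ≥0) := by
    rcases eq_or_ne T 0 with rfl | hT
    · have : s.1 = 0 := le_antisymm s.2.2 s.2.1
      simp [this]
    · have hT' : (T : ℝ) ≠ 0 := by exact_mod_cast hT
      rw [mul_min_of_nonneg _ _ T.coe_nonneg, hσ, hτ, mul_div_cancel₀ _ hT',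
        mul_div_cancel₀ _ hT']
      norm_cast
  rw [← tendsto_add_atTop_iff_nat 1]
  have hsum : ∀ m, ∑ p ∈ levyIdx (m + 1), levyCoeff T p s * levyCoeff T p t =
      T * (σ * τ + ∑ n ∈ Finset.range m, tentKer n σ τ) := by
    intro m
    rw [levyIdx, Finset.sum_sigma, Finset.sum_range_succ', mul_add, Finset.mul_sum, add_comm]
    congr 1
    · simp only [levyCoeff, schauderPath, ContinuousMap.coe_mk, schauder]
      simp only [zero_tsub, pow_zero, Finset.range_one, Finset.sum_singleton]
      rw [← hσ, ← hτ, show √(T : ℝ) * σ * (√(T : ℝ) * τ) = √(T : ℝ) ^ 2 * (σ * τ) by ring,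
        Real.sq_sqrt T.coe_nonneg]
    · refine Finset.sum_congr rfl fun n _ => ?_
      simp only [levyCoeff, schauderPath, ContinuousMap.coe_mk, schauder, tentKer,
        Nat.add_sub_cancel, Finset.mul_sum]
      refine Finset.sum_congr rfl fun k _ => ?_
      rw [← hσ, ← hτ]
      have h2 : (√((2 : ℝ) ^ n))⁻¹ ^ 2 = (2 ^ n)⁻¹ := by
        rw [inv_pow, Real.sq_sqrt (by positivity)]
      calc _ = √(T : ℝ) ^ 2 * ((√((2 : ℝ) ^ n))⁻¹ ^ 2 *
            (tent (2 ^ n * σ - k) * tent (2 ^ n * τ - k))) := by ring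
        _ = _ := by rw [h2, Real.sq_sqrt T.coe_nonneg]
  simp_rw [hsum]
  rw [← hmul]
  refine Tendsto.const_mul _ ?_
  rw [tendsto_iff_dist_tendsto_zero]
  refine squeeze_zero (fun _ => dist_nonneg) (fun m => ?_)
    (tendsto_pow_atTop_nhds_zero_of_lt_one (r := (1 / 2 : ℝ)) (by norm_num) (by norm_num))
  rw [dist_comm, Real.dist_eq, ← sub_sub]
  exact tentKer_approx m hσ0 hσ1 hτ0 hτ1

noncomputable def levyPath (T : ℝ≥0) (ξ : Coeff) : C(Set.Icc (0 : ℝ≥0) T, ℝ) :=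
  ∑' n, levyTerm T n ξ

lemma ae_tendsto_levyPath (T : ℝ≥0) : ∀ᵐ ξ ∂gaussianNoise,
    Tendsto (fun m => ∑ n ∈ Finset.range m, levyTerm T n ξ) atTop (𝓝 (levyPath T ξ)) := by
  filter_upwards [ae_summable_levyTerm T] with ξ hξ
  exact hξ.hasSum.tendsto_sum_nat

lemma aemeasurable_levyPath (T : ℝ≥0) : AEMeasurable (levyPath T) gaussianNoise := by
  refine aemeasurable_of_tendsto_metrizable_ae atTop (fun m => ?_) (ae_tendsto_levyPath T)
  exact (Finset.measurable_fun_sum _ fun n _ => measurable_levyTerm T n).aemeasurable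

/-- Wiener measure on `C([0, T], ℝ)`: the law of standard Brownian motion started at `0`. -/
noncomputable def wienerMeasure (T : ℝ≥0) : Measure C(Set.Icc (0 : ℝ≥0) T, ℝ) :=
  gaussianNoise.map (levyPath T)

instance (T : ℝ≥0) : IsProbabilityMeasure (wienerMeasure T) :=
  Measure.isProbabilityMeasure_map (aemeasurable_levyPath T)

/-- The finite-dimensional laws of Wiener measure are those of Brownian motion: centered Gaussian
with covariance `min s t`. -/
theorem wienerMeasure_map_restrict (T : ℝ≥0) (I : Finset ℝ≥0) (hI : ∀ t ∈ I, t ≤ T) :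
    (wienerMeasure T).map (fun ω (t : I) => ω ⟨t, zero_le, hI t t.2⟩) =
      BrownianReal.projectiveFamily I := by
  set g : C(Set.Icc (0 : ℝ≥0) T, ℝ) → (I → ℝ) := fun ω t => ω ⟨t, zero_le, hI t t.2⟩ with hg
  have hgc : Continuous g := continuous_pi fun t => continuous_eval_const _
  have hgm : Measurable g := hgc.measurable
  apply (MeasurableEquiv.toLp 2 (I → ℝ)).map_measurableEquiv_injective
  rw [MeasurableEquiv.coe_toLp,
    (BrownianReal.measurePreserving_toLp_projectiveFamily I).map_eq,
    Measure.map_map (by fun_prop) hgm]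
  have hm2 : Measurable (WithLp.toLp 2 ∘ g : _ → EuclideanSpace ℝ I) :=
    Measurable.comp (by fun_prop) hgm
  have : IsProbabilityMeasure ((wienerMeasure T).map (WithLp.toLp 2 ∘ g)) :=
    Measure.isProbabilityMeasure_map hm2.aemeasurable
  refine Measure.ext_of_charFun ?_
  ext a
  rw [charFun_multivariateGaussian (BrownianReal.posSemidef_covMatrix I), charFun_apply,
    integral_map hm2.aemeasurable (by fun_prop), wienerMeasure,
    integral_map (aemeasurable_levyPath T)]
  swap
  · have : Continuous fun ω => Complex.exp ((inner ℝ ((WithLp.toLp 2 ∘ g) ω) a : ℝ) * Complex.I) := by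
      have : Continuous (WithLp.toLp 2 ∘ g : _ → EuclideanSpace ℝ I) :=
        (PiLp.continuous_toLp 2 _).comp hgc
      fun_prop
    exact this.measurable.aestronglyMeasurable
  have hinner : ∀ ω, (inner ℝ ((WithLp.toLp 2 ∘ g) ω) a : ℝ) = ∑ t : I, a t * g ω t := by
    intro ω
    simp [PiLp.inner_apply]
  simp_rw [hinner]
  set c : (Σ _ : ℕ, ℕ) → ℝ := fun p => ∑ t : I, a t * levyCoeff T p ⟨t, zero_le, hI t t.2⟩ with hc
  have happrox : ∀ m ξ, ∑ t : I, a t * g (∑ n ∈ Finset.range m, levyTerm T n ξ) t =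
      ∑ p ∈ levyIdx m, c p * ξ p := by
    intro m ξ
    simp_rw [hg, sum_levyTerm_apply, hc, Finset.mul_sum, Finset.sum_mul]
    rw [Finset.sum_comm]
    simp_rw [mul_assoc]
  have hlim1 : Tendsto (fun m => ∫ ξ, Complex.exp ((∑ p ∈ levyIdx m, c p * ξ p : ℝ) * Complex.I)
      ∂gaussianNoise) atTop (𝓝 (∫ ξ, Complex.exp ((∑ t : I, a t * g (levyPath T ξ) t : ℝ) *
        Complex.I) ∂gaussianNoise)) := by
    refine tendsto_integral_of_dominated_convergence (fun _ => 1) (fun m => ?_)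
      (integrable_const _) (fun m => ae_of_all _ fun ξ => ?_) ?_
    · have : Measurable fun ξ : Coeff => ∑ p ∈ levyIdx m, c p * ξ p := by
        refine Finset.measurable_fun_sum _ fun p _ => ?_
        have h : Measurable fun ξ : Coeff => ξ p := measurable_pi_apply p
        exact h.const_mul (c p)
      exact Measurable.aestronglyMeasurable (by fun_prop)
    · rw [Complex.norm_exp_ofReal_mul_I]
    · filter_upwards [ae_tendsto_levyPath T] with ξ hξ
      simp_rw [← happrox]
      have : Continuous fun ω => Complex.exp ((∑ t : I, a t * g ω t : ℝ) * Complex.I) := by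
        have : ∀ t, Continuous fun ω => g ω t := fun t => (continuous_apply t).comp hgc
        fun_prop
      exact (this.tendsto _).comp hξ
  refine tendsto_nhds_unique hlim1 ?_
  simp_rw [integral_exp_noise]
  have hsq : ∀ m, ∑ p ∈ levyIdx m, c p ^ 2 = ∑ s : I, ∑ t : I, a s * (a t *
      ∑ p ∈ levyIdx m, levyCoeff T p ⟨s, zero_le, hI s s.2⟩ *
        levyCoeff T p ⟨t, zero_le, hI t t.2⟩) := by
    intro m
    simp_rw [hc, sq, Finset.sum_mul_sum, Finset.mul_sum]
    rw [Finset.sum_comm]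
    refine Finset.sum_congr rfl fun s _ => ?_
    rw [Finset.sum_comm]
    refine Finset.sum_congr rfl fun t _ => Finset.sum_congr rfl fun p _ => by ring
  have hlim2 : Tendsto (fun m => ∑ p ∈ levyIdx m, c p ^ 2) atTop
      (𝓝 (∑ s : I, ∑ t : I, a s * (a t * (min s.1 t.1 : ℝ≥0)))) := by
    simp_rw [hsq]
    refine tendsto_finsetSum _ fun s _ => tendsto_finsetSum _ fun t _ => ?_
    exact ((tendsto_covariance T _ _).const_mul _).const_mul _
  have hfin : a ⬝ᵥ (BrownianReal.covMatrix I).mulVec a =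
      ∑ s : I, ∑ t : I, a s * (a t * (min s.1 t.1 : ℝ≥0)) := by
    simp only [dotProduct, Matrix.mulVec, BrownianReal.covMatrix_apply, Finset.mul_sum]
    refine Finset.sum_congr rfl fun s _ => Finset.sum_congr rfl fun t _ => ?_
    push_cast
    ring
  rw [hfin, inner_zero_right]
  have hcont : Continuous fun x : ℝ => Complex.exp (-(x : ℂ) / 2) := by fun_prop
  have := (hcont.tendsto _).comp hlim2
  rw [Complex.ofReal_zero, zero_mul, zero_sub, ← neg_div]
  exact this

/-! ### The discretized problems on the torus -/

/-- `ℝ^d / 2πℤ^d`. -/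
abbrev Torus (d : ℕ) : Type := Fin d → AddCircle (2 * Real.pi)

instance two_pi_pos_fact : Fact (0 < 2 * Real.pi) := ⟨Real.two_pi_pos⟩

/-- The Lebesgue measure of the torus, normalized to be a probability measure. -/
noncomputable def leb (d : ℕ) : Measure (Torus d) :=
  Measure.pi fun _ => AddCircle.haarAddCircle

instance (d : ℕ) : IsProbabilityMeasure (leb d) := by unfold leb; infer_instance

/-- `C([0, T], 𝕋^d)` with the topology of uniform convergence and its Borel `σ`-algebra. -/
abbrev PathSpace (d : ℕ) (T : ℝ≥0) : Type := C(Set.Icc (0 : ℝ≥0) T, Torus d)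

def startTime (T : ℝ≥0) : Set.Icc (0 : ℝ≥0) T := ⟨0, le_rfl, zero_le⟩

def endTime (T : ℝ≥0) : Set.Icc (0 : ℝ≥0) T := ⟨T, zero_le, le_rfl⟩

/-- The time `k T / N`. -/
noncomputable def gridTime (T : ℝ≥0) (N : ℕ) (k : Fin (N + 1)) : Set.Icc (0 : ℝ≥0) T :=
  ⟨k * (T / N), zero_le, by
    rcases Nat.eq_zero_or_pos N with rfl | hN
    · simp
    · have hk : ((k : ℕ) : ℝ≥0) ≤ N := by exact_mod_cast Nat.lt_succ_iff.1 k.2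
      have hN' : (N : ℝ≥0) ≠ 0 := by exact_mod_cast hN.ne'
      calc ((k : ℕ) : ℝ≥0) * (T / N) ≤ N * (T / N) := by gcongr
        _ = T := mul_div_cancel₀ T hN'⟩

/-- `P_N`, the restriction of a path to the time grid. -/
noncomputable def gridEval (d : ℕ) (T : ℝ≥0) (N : ℕ) (ω : PathSpace d T) :
    Fin (N + 1) → Torus d :=
  fun k => ω (gridTime T N k)

/-- The set `GIF_N(π)` of generalized incompressible flows, discretized in time. -/
def GIF (d : ℕ) (T : ℝ≥0) (N : ℕ) (π : Measure (Torus d × Torus d)) :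
    Set (Measure (PathSpace d T)) :=
  {Q | IsProbabilityMeasure Q ∧
    (∀ k, Q.map (fun ω => ω (gridTime T N k)) = leb d) ∧
    Q.map (fun ω => (ω (startTime T), ω (endTime T))) = π}

/-- The set `Γ_N(π)` of multi-marginal plans. -/
def Plans (d N : ℕ) (π : Measure (Torus d × Torus d)) : Set (Measure (Fin (N + 1) → Torus d)) :=
  {γ | IsProbabilityMeasure γ ∧
    (∀ k, γ.map (fun x => x k) = leb d) ∧
    γ.map (fun x => (x 0, x (Fin.last N))) = π}

/-- The path `t ↦ x + √ε b(t)` modulo `2πℤ^d`. -/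
noncomputable def brownianPath {d : ℕ} {T : ℝ≥0} (ε : ℝ)
    (p : Torus d × (Fin d → C(Set.Icc (0 : ℝ≥0) T, ℝ))) : PathSpace d T where
  toFun t i := p.1 i + ((√ε * p.2 i t : ℝ) : AddCircle (2 * Real.pi))
  continuous_toFun := by
    have : Continuous ((↑) : ℝ → AddCircle (2 * Real.pi)) := AddCircle.continuous_mk' _
    fun_prop

lemma continuous_brownianPath {d : ℕ} {T : ℝ≥0} (ε : ℝ) :
    Continuous (brownianPath ε : Torus d × (Fin d → C(Set.Icc (0 : ℝ≥0) T, ℝ)) → _) := by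
  refine ContinuousMap.continuous_of_continuous_uncurry _ ?_
  have : Continuous ((↑) : ℝ → AddCircle (2 * Real.pi)) := AddCircle.continuous_mk' _
  unfold brownianPath Function.uncurry
  simp only [ContinuousMap.coe_mk]
  fun_prop

/-- The reference measure `R_ε`: the law of `x + √ε B` modulo `2πℤ^d`, where the starting point `x`
is uniform on the torus and `B` is an independent standard Brownian motion of `ℝ^d`, i.e. has
independent coordinates whose laws are the Wiener measure. -/
noncomputable def refLaw (d : ℕ) (T : ℝ≥0) (ε : ℝ) : Measure (PathSpace d T) :=
  ((leb d).prod (Measure.pi fun _ : Fin d => wienerMeasure T)).map (brownianPath ε)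

instance (d : ℕ) (T : ℝ≥0) (ε : ℝ) : IsProbabilityMeasure (refLaw d T ε) :=
  Measure.isProbabilityMeasure_map (continuous_brownianPath ε).measurable.aemeasurable

/-- `θ_{N,ε}`, the law of `R_ε` on the time grid. -/
noncomputable def refGridLaw (d : ℕ) (T : ℝ≥0) (N : ℕ) (ε : ℝ) : Measure (Fin (N + 1) → Torus d) :=
  (refLaw d T ε).map (gridEval d T N)

/-- `κ` is a family `x ↦ R_ε^x` of Brownian bridges: a regular conditional law, under `R_ε`, of the
path `ω` given that `P_N ω = x`. -/
def IsBrownianBridge (d : ℕ) (T : ℝ≥0) (N : ℕ) (ε : ℝ)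
    (κ : Kernel (Fin (N + 1) → Torus d) (PathSpace d T)) : Prop :=
  (refGridLaw d T N ε) ⊗ₘ κ = (refLaw d T ε).map fun ω => (gridEval d T N ω, ω)

/-- Such a family exists. -/
lemma isBrownianBridge_condDistrib (d : ℕ) (T : ℝ≥0) (N : ℕ) (ε : ℝ) :
    IsBrownianBridge d T N ε (condDistrib id (gridEval d T N) (refLaw d T ε)) :=
  compProd_map_condDistrib aemeasurable_id

/-- `q` solves the problem `inf_{q' ∈ S} H(q' | r)`. -/
def SolvesEntropyMin {α : Type*} [MeasurableSpace α] (S : Set (Measure α)) (r q : Measure α) :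
    Prop :=
  q ∈ S ∧ ∀ q' ∈ S, InformationTheory.klDiv q r ≤ InformationTheory.klDiv q' r

end Bredinger

/-! Write θ for the law of the grid values under R and γ for their law under Q. The chain rule
splits H(Q|R) into H(γ|θ) plus the entropy of the conditional laws of Q given the grid values,
relative to the bridges and averaged over γ. All constraints on Q bear on γ alone (`mem_GIF_iff`),
because 0 and T are grid times. So the conditional laws may be chosen freely, and the bridges, which
make the second term vanish, are the optimal choice.

The abstract form is `solvesEntropyMin_iff_of_disintegration`. Data processing gives H(γ|θ) ≤ H(Q|R)
and H(γκ|R) ≤ H(γ|θ) for the mixture γκ of bridges, so the two infima can be compared. If Q is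
optimal, comparing it with its own mixture γκ forces the second term of the chain rule to be zero,
that is Q = γκ.

This last step cancels H(γ|θ), so it needs the infimum to be finite: were it infinite, every
admissible Q would be optimal, bridges or not. Most of the file serves to exhibit a plan of finite
entropy. Draw the endpoints from π and the other points independently and uniformly; relative to
Leb^(N+1) the entropy of this plan is at most that of π relative to Leb ⊗ Leb. To pass to θ, note
that θ is the law of a random walk on the torus with wrapped Gaussian increments of positive
variance. These dominate Haar measure up to a constant, hence θ dominates Leb^(N+1) up to a constant
(`exists_pi_leb_le_refGridLaw`), and finiteness survives the change of reference
(`klDiv_ne_top_of_le_smul`). -/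

namespace Bredinger

open InformationTheory

/-! ### Relative entropy -/

section Entropy

variable {α β : Type*} [MeasurableSpace α] [MeasurableSpace β]

/-- Finiteness of the relative entropy is preserved when the reference measure is replaced by one
that dominates it up to a constant. -/
lemma klDiv_ne_top_of_le_smul {μ ν θ : Measure α} [IsFiniteMeasure μ] [IsFiniteMeasure ν]
    [IsFiniteMeasure θ] {C : ℝ≥0} (hC : ν ≤ C • θ) (h : klDiv μ ν ≠ ∞) : klDiv μ θ ≠ ∞ := by
  obtain ⟨hμν, hint⟩ := klDiv_ne_top_iff.1 h
  have hνθ : ν ≪ θ := (Measure.absolutelyContinuous_of_le hC).trans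
    Measure.smul_absolutelyContinuous
  have hμθ := hμν.trans hνθ
  refine klDiv_ne_top hμθ ((integrable_rnDeriv_mul_log_iff hμθ).1 ?_)
  have hbd : ∀ᵐ x ∂θ, ν.rnDeriv θ x ≤ C := by
    refine ae_le_of_forall_setLIntegral_le_of_sigmaFinite (Measure.measurable_rnDeriv _ _)
      fun s hs _ => ?_
    rw [Measure.setLIntegral_rnDeriv hνθ, setLIntegral_const]
    exact hC s
  have hint2 := (integrable_toReal_rnDeriv_mul_iff (f := fun x => llr μ ν x + Real.log C) hμθ).2
    (hint.add (integrable_const _))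
  -- With f the density of μ with respect to θ, f log f lies between -1, since t log t ≥ t - 1, and
  -- f (log dμ/dν + log C), by the chain rule for densities and dν/dθ ≤ C.
  refine integrable_of_le_of_le (g₁ := fun _ => -1) ?_ (ae_of_all _ fun x => ?_) ?_
    (integrable_const _) hint2
  · have := Measure.measurable_rnDeriv μ θ
    exact Measurable.aestronglyMeasurable (by fun_prop)
  · have h0 := ENNReal.toReal_nonneg (a := μ.rnDeriv θ x)
    rcases eq_or_lt_of_le h0 with h0 | h0
    · simp [← h0]
    have := Real.one_sub_inv_le_log_of_pos h0
    have h2 := mul_le_mul_of_nonneg_left this h0.le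
    rw [mul_sub, mul_inv_cancel₀ h0.ne'] at h2
    linarith
  · filter_upwards [hbd, Measure.rnDeriv_mul_rnDeriv hμν (κ := θ)] with x hx hmul
    rcases eq_or_ne (μ.rnDeriv θ x).toReal 0 with h0 | h0
    · simp [h0]
    refine mul_le_mul_of_nonneg_left ?_ ENNReal.toReal_nonneg
    rw [← hmul, Pi.mul_apply, ENNReal.toReal_mul] at h0 ⊢
    have h1 := left_ne_zero_of_mul h0
    have h2 := right_ne_zero_of_mul h0
    rw [Real.log_mul h1 h2, llr]
    gcongr
    exact ENNReal.toReal_le_of_le_ofReal C.coe_nonneg (by simpa using hx)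

/-- Relative entropy is not changed by adjoining a measurable function of the variable. -/
lemma klDiv_map_prodMk_id {g : α → β} (hg : Measurable g) (μ ν : Measure α) [IsFiniteMeasure μ]
    [IsFiniteMeasure ν] :
    klDiv (μ.map fun a => (g a, a)) (ν.map fun a => (g a, a)) = klDiv μ ν := by
  have hm : Measurable fun a => (g a, a) := hg.prodMk measurable_id
  refine le_antisymm (klDiv_map_le _ _ hm) ?_
  -- The second projection undoes the map, so data processing also gives the converse inequality.
  have h := klDiv_map_le (μ.map fun a => (g a, a)) (ν.map fun a => (g a, a)) measurable_snd
  have e : (Prod.snd ∘ fun a => (g a, a)) = id := rfl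
  rwa [Measure.map_map measurable_snd hm, Measure.map_map measurable_snd hm, e, Measure.map_id,
    Measure.map_id] at h

/-- A disintegration along `g` of one measure disintegrates every mixture whose weights are
absolutely continuous. -/
lemma compProd_eq_map_bind [MeasurableEq β]
    {g : α → β} (hg : Measurable g) {R : Measure α} [IsFiniteMeasure R] {κ : Kernel β α}
    [IsMarkovKernel κ] (hκ : (R.map g) ⊗ₘ κ = R.map fun a => (g a, a)) {γ : Measure β}
    [IsFiniteMeasure γ] (hγ : γ ≪ R.map g) :
    γ ⊗ₘ κ = (γ.bind κ).map fun a => (g a, a) := by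
  have hm : Measurable fun a => (g a, a) := hg.prodMk measurable_id
  have hs : MeasurableSet {p : β × α | p.1 = g p.2} :=
    measurableSet_eq_fun measurable_fst (hg.comp measurable_snd)
  -- The disintegration of R lives on the graph of g, and absolute continuity of γ carries this over
  -- to γ ⊗ κ. On the graph, a pair is determined by its second entry.
  have h1 : ∀ᵐ p ∂((R.map g) ⊗ₘ κ), p.1 = g p.2 := by
    rw [hκ, ae_map_iff hm.aemeasurable hs]
    exact ae_of_all _ fun _ => rfl
  have h2 : ∀ᵐ p ∂(γ ⊗ₘ κ), p.1 = g p.2 := (hγ.compProd_left κ).ae_le h1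
  rw [← Measure.snd_compProd, Measure.snd, Measure.map_map hm measurable_snd]
  conv_lhs => rw [← Measure.map_id (μ := γ ⊗ₘ κ)]
  refine Measure.map_congr ?_
  filter_upwards [h2] with p hp
  exact Prod.ext hp rfl

variable [StandardBorelSpace α] [Nonempty α] [MeasurableEq β]

/-- Minimizing relative entropy over a set of measures defined by constraints on `g` amounts to
minimizing the relative entropy of the law of `g`, with the conditional laws given by those of the
reference measure. -/
lemma solvesEntropyMin_iff_of_disintegration {g : α → β} (hg : Measurable g) {R : Measure α}
    [IsFiniteMeasure R] {κ : Kernel β α} [IsMarkovKernel κ]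
    (hκ : (R.map g) ⊗ₘ κ = R.map fun a => (g a, a)) {S : Set (Measure α)} {Γ : Set (Measure β)}
    (hSfin : ∀ q ∈ S, IsProbabilityMeasure q) (hΓfin : ∀ γ ∈ Γ, IsProbabilityMeasure γ)
    (hS : ∀ q, IsProbabilityMeasure q → (q ∈ S ↔ q.map g ∈ Γ))
    (hfin : ∃ γ ∈ Γ, klDiv γ (R.map g) ≠ ∞) {q : Measure α} (hq : q ∈ S) :
    SolvesEntropyMin S R q ↔ SolvesEntropyMin Γ (R.map g) (q.map g) ∧ q = (q.map g).bind κ := by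
  have := hSfin q hq
  have hqg : IsProbabilityMeasure (q.map g) := Measure.isProbabilityMeasure_map hg.aemeasurable
  have hm : Measurable fun a => (g a, a) := hg.prodMk measurable_id
  have hR : (R.map g).bind κ = R := by
    rw [← Measure.snd_compProd, hκ, Measure.snd, Measure.map_map measurable_snd hm]
    exact Measure.map_id
  have hle : ∀ γ : Measure β, IsFiniteMeasure γ → klDiv (γ.bind κ) R ≤ klDiv γ (R.map g) := by
    intro γ _
    conv_lhs => rw [← hR]
    exact klDiv_comp_right_le _ _ κ
  -- The kernel is concentrated on the fibres of g only almost everywhere for the law of g under R.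
  -- Finite entropy supplies the absolute continuity that makes γ the law of g under the mixture.
  have hmem : ∀ γ ∈ Γ, klDiv γ (R.map g) ≠ ∞ → γ.bind κ ∈ S := by
    intro γ hγ hγfin
    have := hΓfin γ hγ
    have hpb : IsProbabilityMeasure (γ.bind κ) := by
      rw [← Measure.snd_compProd]; infer_instance
    rw [hS _ hpb]
    have h := congrArg Measure.fst (compProd_eq_map_bind hg hκ (klDiv_ne_top_iff.1 hγfin).1)
    rw [Measure.fst_compProd, Measure.fst, Measure.map_map measurable_fst hm] at h
    have e : (Prod.fst ∘ fun a => (g a, a)) = g := rfl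
    rwa [← e, ← h]
  have hmap : ∀ q' ∈ S, klDiv (q'.map g) (R.map g) ≤ klDiv q' R := fun q' hq' => by
    have := hSfin q' hq'
    exact klDiv_map_le _ _ hg
  constructor
  · rintro ⟨-, hmin⟩
    have hmin' : ∀ γ ∈ Γ, klDiv q R ≤ klDiv γ (R.map g) := by
      intro γ hγ
      by_cases h : klDiv γ (R.map g) = ∞
      · simp [h]
      have := hΓfin γ hγ
      exact (hmin _ (hmem γ hγ h)).trans (hle γ inferInstance)
    have hqΓ : q.map g ∈ Γ := (hS q this).1 hq
    refine ⟨⟨hqΓ, fun γ hγ => (hmap q hq).trans (hmin' γ hγ)⟩, ?_⟩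
    -- The finite competitor makes the entropy of the law of g finite, so that it can be cancelled
    -- in the chain rule.
    obtain ⟨γ₀, hγ₀, hγ₀fin⟩ := hfin
    have hqfin : klDiv (q.map g) (R.map g) ≠ ∞ :=
      ne_top_of_le_ne_top hγ₀fin ((hmap q hq).trans (hmin' _ hγ₀))
    have hdis : q.map (fun a => (g a, a)) = (q.map g) ⊗ₘ condDistrib id g q :=
      (compProd_map_condDistrib aemeasurable_id).symm
    have hchain := klDiv_compProd_eq_add (q.map g) (R.map g) (condDistrib id g q) κ
    rw [← hdis, hκ, klDiv_map_prodMk_id hg] at hchain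
    -- Optimality against the mixture with the same grid law bounds the total entropy by the first
    -- term of the chain rule, so nothing is left for the conditional term.
    have h0 : klDiv (q.map fun a => (g a, a)) ((q.map g) ⊗ₘ κ) = 0 := by
      have h := hmin' _ hqΓ
      rw [hchain] at h
      exact nonpos_iff_eq_zero.1 ((ENNReal.add_le_add_iff_left hqfin).1 (by simpa using h))
    have : IsFiniteMeasure (q.map fun a => (g a, a)) := by infer_instance
    have h1 := congrArg Measure.snd (klDiv_eq_zero_iff.1 h0)
    rwa [Measure.snd_compProd, Measure.snd, Measure.map_map measurable_snd hm,
      show (Prod.snd ∘ fun a => (g a, a)) = id from rfl, Measure.map_id] at h1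
  · rintro ⟨⟨hqΓ, hmin⟩, hbind⟩
    refine ⟨hq, fun q' hq' => ?_⟩
    have h := hle (q.map g) inferInstance
    rw [← hbind] at h
    exact h.trans ((hmin _ ((hS q' (hSfin q' hq')).1 hq')).trans (hmap q' hq'))

end Entropy

/-! ### Domination of product measures -/

/-- A comparison on boxes suffices because the product outer measure is the largest one bounded on
boxes by the products of the side measures. The constants are first absorbed into the factors. -/
lemma pi_le_smul_pi {ι : Type*} [Fintype ι] {α : ι → Type*} [∀ i, MeasurableSpace (α i)]
    {μ ν : ∀ i, Measure (α i)} [∀ i, SigmaFinite (μ i)] [∀ i, SigmaFinite (ν i)]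
    {C : ι → ℝ≥0} (h : ∀ i, μ i ≤ C i • ν i) :
    Measure.pi μ ≤ (∏ i, C i) • Measure.pi ν := by
  have e : (∏ i, C i) • Measure.pi ν = Measure.pi fun i => C i • ν i := by
    refine (Measure.pi_eq fun s _ => ?_).symm
    simp only [Measure.smul_apply, Measure.pi_pi, ENNReal.smul_def, smul_eq_mul,
      Finset.prod_mul_distrib, ENNReal.ofNNReal_finsetProd]
  rw [e]
  refine Measure.le_iff.2 fun s hs => ?_
  have h1 : (Measure.pi μ).toOuterMeasure ≤
      OuterMeasure.pi fun i => (C i • ν i).toOuterMeasure := by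
    refine OuterMeasure.le_pi.2 fun t _ => ?_
    change Measure.pi μ _ ≤ _
    rw [Measure.pi_pi]
    exact Finset.prod_le_prod' fun i _ => h i (t i)
  rw [Measure.pi, Measure.pi, toMeasure_apply _ _ hs, toMeasure_apply _ _ hs]
  refine le_trans (le_of_eq ?_) (h1 s)
  change _ = Measure.pi μ s
  rw [Measure.pi, toMeasure_apply _ _ hs]

/-! ### The increments of Wiener measure -/

lemma hasLaw_wienerMeasure (T : ℝ≥0) (I : Finset ℝ≥0) (hI : ∀ t ∈ I, t ≤ T) :
    HasLaw (fun (ω : C(Set.Icc (0 : ℝ≥0) T, ℝ)) (t : I) => ω ⟨t, zero_le, hI t t.2⟩)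
      (BrownianReal.projectiveFamily I) (wienerMeasure T) :=
  ⟨(continuous_pi fun _ => continuous_eval_const _).measurable.aemeasurable,
    wienerMeasure_map_restrict T I hI⟩

lemma isGaussianProcess_wienerMeasure (T : ℝ≥0) :
    IsGaussianProcess (fun t (ω : C(Set.Icc (0 : ℝ≥0) T, ℝ)) => ω t) (wienerMeasure T) where
  hasGaussianLaw I := by
    classical
    have hJ : ∀ t ∈ I.image Subtype.val, t ≤ T := by
      intro t ht
      obtain ⟨s, -, rfl⟩ := Finset.mem_image.1 ht
      exact s.2.2
    -- Reindexing between times in `[0, T]` and times in `ℝ≥0` is linear, so it preserves Gaussian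
    -- laws.
    let L : (↥(I.image Subtype.val) → ℝ) →L[ℝ] (I → ℝ) :=
      ContinuousLinearMap.pi fun t =>
        ContinuousLinearMap.proj ⟨t.1.1, Finset.mem_image_of_mem _ t.2⟩
    exact (hasLaw_wienerMeasure T _ hJ).hasGaussianLaw.map L

lemma covariance_wienerMeasure (T : ℝ≥0) (s t : Set.Icc (0 : ℝ≥0) T) :
    cov[fun ω : C(Set.Icc (0 : ℝ≥0) T, ℝ) => ω s, fun ω => ω t; wienerMeasure T] =
      min (s : ℝ≥0) t := by
  have hI : ∀ r ∈ ({s.1, t.1} : Finset ℝ≥0), r ≤ T := by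
    intro r hr
    rcases Finset.mem_insert.1 hr with rfl | hr
    · exact s.2.2
    · rw [Finset.mem_singleton.1 hr]; exact t.2.2
  have h := (hasLaw_wienerMeasure T _ hI).covariance_fun_comp
    (f := fun x => x ⟨s, by simp⟩) (g := fun x => x ⟨t, by simp⟩)
    (Measurable.aemeasurable (by fun_prop)) (Measurable.aemeasurable (by fun_prop))
  rw [BrownianReal.covariance_eval_projectiveFamily] at h
  exact h

lemma wienerMeasure_map_increment (T : ℝ≥0) (s t : Set.Icc (0 : ℝ≥0) T) :
    (wienerMeasure T).map (fun ω => ω s - ω t) = gaussianReal 0 (nndist s.1 t.1) := by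
  have hI : ∀ r ∈ ({s.1, t.1} : Finset ℝ≥0), r ≤ T := by
    intro r hr
    rcases Finset.mem_insert.1 hr with rfl | hr
    · exact s.2.2
    · rw [Finset.mem_singleton.1 hr]; exact t.2.2
  exact ((BrownianReal.measurePreserving_eval_sub_eval_projectiveFamily {s.1, t.1}
    ⟨s, by simp⟩ ⟨t, by simp⟩).hasLaw.comp (hasLaw_wienerMeasure T _ hI)).map_eq

lemma ae_eval_startTime_wienerMeasure (T : ℝ≥0) :
    ∀ᵐ ω ∂(wienerMeasure T), ω (startTime T) = 0 := by
  have h := (BrownianReal.measurePreserving_eval_projectiveFamily (I := {0})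
    ⟨0, by simp⟩).hasLaw.comp (hasLaw_wienerMeasure T {0} (by simp))
  rw [gaussianReal_zero_var] at h
  exact h.ae_eq_of_dirac

/-- Brownian motion has independent Gaussian increments. -/
lemma wienerMeasure_map_increments (T : ℝ≥0) {n : ℕ} {t : Fin (n + 1) → Set.Icc (0 : ℝ≥0) T}
    (ht : Monotone t) :
    (wienerMeasure T).map (fun ω (j : Fin n) => ω (t j.succ) - ω (t j.castSucc)) =
      Measure.pi fun j => gaussianReal 0 (nndist (t j.succ).1 (t j.castSucc).1) := by
  have hG := isGaussianProcess_wienerMeasure T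
  have hm : ∀ j : Fin n, AEMeasurable (fun ω : C(Set.Icc (0 : ℝ≥0) T, ℝ) =>
      ω (t j.succ) - ω (t j.castSucc)) (wienerMeasure T) := fun j =>
    ((continuous_eval_const _).sub (continuous_eval_const _)).measurable.aemeasurable
  have hind : iIndepFun (fun (j : Fin n) (ω : C(Set.Icc (0 : ℝ≥0) T, ℝ)) =>
      ω (t j.succ) - ω (t j.castSucc)) (wienerMeasure T) := by
    -- For jointly Gaussian variables, independence reduces to vanishing covariances.
    refine (hG.hasGaussianLaw_increments (t := t)).iIndepFun_of_covariance_eq_zero fun i j hij => ?_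
    rw [covariance_fun_sub_fun_sub]
    · simp_rw [covariance_wienerMeasure]
      wlog h : i < j generalizing i j
      · have := this j i hij.symm (lt_of_le_of_ne (not_lt.1 h) hij.symm)
        simp_rw [min_comm] at this ⊢
        linarith
      -- The i-th time interval ends before the j-th begins, so each of the four minima is the
      -- endpoint of the i-th interval and they cancel in pairs.
      have h1 : (t i.succ).1 ≤ t j.succ := ht (Fin.strictMono_succ h).le
      have h2 : (t i.castSucc).1 ≤ t j.succ := ht
        (Fin.le_of_lt ((Fin.castSucc_lt_castSucc_iff.2 h).trans_le (Fin.castSucc_le_succ j)))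
      have h3 : (t i.castSucc).1 ≤ t j.castSucc :=
        ht (Fin.castSucc_le_castSucc_iff.2 h.le)
      have h4 : (t i.succ).1 ≤ t j.castSucc := ht (Fin.succ_le_castSucc_iff.2 h)
      rw [min_eq_left h1, min_eq_left h2, min_eq_left h3, min_eq_left h4]
      simp
    all_goals exact (hG.hasGaussianLaw_eval _).memLp_two
  rw [(iIndepFun_iff_map_fun_eq_pi_map hm).1 hind]
  simp_rw [wienerMeasure_map_increment]

/-! ### Wrapped Gaussian measures -/

/-- A nondegenerate Gaussian measure dominates Lebesgue measure on a bounded interval. -/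
lemma exists_restrict_Ioc_le_gaussianReal {v : ℝ≥0} (hv : v ≠ 0) (a b : ℝ) :
    ∃ C : ℝ≥0, volume.restrict (Set.Ioc a b) ≤ C • gaussianReal 0 v := by
  -- c is the minimum of the positive continuous density on the compact interval; the constant C is
  -- its inverse.
  obtain ⟨c, hc0, hc⟩ : ∃ c : ℝ, 0 < c ∧ ∀ x ∈ Set.Ioc a b, c ≤ gaussianPDFReal 0 v x := by
    have hcont : Continuous (gaussianPDFReal 0 v) := by unfold gaussianPDFReal; fun_prop
    rcases (Set.Icc a b).eq_empty_or_nonempty with h | h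
    · exact ⟨1, one_pos, fun x hx => by
        simpa [h] using (Set.Ioc_subset_Icc_self hx : x ∈ Set.Icc a b)⟩
    obtain ⟨y, -, hy⟩ := isCompact_Icc.exists_isMinOn h hcont.continuousOn
    exact ⟨_, gaussianPDFReal_pos 0 v y hv, fun x hx => hy (Set.Ioc_subset_Icc_self hx)⟩
  refine ⟨(Real.toNNReal c)⁻¹, Measure.le_iff.2 fun s hs => ?_⟩
  have hc' : (Real.toNNReal c) ≠ 0 := by simpa using hc0
  rw [Measure.restrict_apply hs, Measure.smul_apply, gaussianReal_of_var_ne_zero _ hv,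
    withDensity_apply _ hs, ENNReal.smul_def, smul_eq_mul, ENNReal.coe_inv hc',
    mul_comm, ← div_eq_mul_inv,
    ENNReal.le_div_iff_mul_le (Or.inl (by simpa using hc')) (Or.inl (by simp)), mul_comm,
    ← setLIntegral_const]
  refine (setLIntegral_mono_ae' (hs.inter measurableSet_Ioc)
    (g := gaussianPDF 0 v) (ae_of_all _ fun x hx => ?_)).trans
    (lintegral_mono_set Set.inter_subset_left)
  exact ENNReal.ofReal_le_ofReal (hc x hx.2)

/-- The law of a centered Gaussian variable modulo `2πℤ`. -/
noncomputable def wrappedGaussian (v : ℝ≥0) : Measure (AddCircle (2 * Real.pi)) :=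
  (gaussianReal 0 v).map (↑)

instance (v : ℝ≥0) : IsProbabilityMeasure (wrappedGaussian v) :=
  Measure.isProbabilityMeasure_map AddCircle.measurable_mk'.aemeasurable

/-- Lebesgue measure on one full period wraps onto the volume of the circle, so the domination on
that interval passes to the quotient. The factor 1/(2π) normalizes the volume. -/
lemma exists_haar_le_wrappedGaussian {v : ℝ≥0} (hv : v ≠ 0) :
    ∃ C : ℝ≥0, AddCircle.haarAddCircle ≤ C • wrappedGaussian v := by
  obtain ⟨C, hC⟩ := exists_restrict_Ioc_le_gaussianReal hv 0 (0 + 2 * Real.pi)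
  have h := Measure.map_mono hC (AddCircle.measurable_mk' (a := 2 * Real.pi))
  rw [(AddCircle.measurePreserving_mk (2 * Real.pi) 0).map_eq, Measure.map_smul] at h
  refine ⟨(Real.toNNReal (2 * Real.pi))⁻¹ * C, ?_⟩
  have hpi : Real.toNNReal (2 * Real.pi) ≠ 0 := by simpa using Real.pi_pos
  have e : AddCircle.haarAddCircle = (Real.toNNReal (2 * Real.pi))⁻¹ •
      (volume : Measure (AddCircle (2 * Real.pi))) := by
    rw [AddCircle.volume_eq_smul_haarAddCircle]
    change _ = (Real.toNNReal (2 * Real.pi))⁻¹ • (Real.toNNReal (2 * Real.pi) • AddCircle.haarAddCircle)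
    rw [smul_smul, inv_mul_cancel₀ hpi, one_smul]
  rw [e, mul_smul]
  intro s
  simp only [Measure.smul_apply, ENNReal.smul_def, smul_eq_mul]
  gcongr
  exact h s

/-! ### The law of the reference process on the time grid -/

instance (d : ℕ) : SecondCountableTopology (Torus d) := inferInstance

instance (n d : ℕ) : BorelSpace (Fin n → Torus d) := Pi.borelSpace

lemma gridTime_zero (T : ℝ≥0) (N : ℕ) : gridTime T N 0 = startTime T := by
  simp [gridTime, startTime]

lemma gridTime_last (T : ℝ≥0) {N : ℕ} (hN : 1 ≤ N) :
    gridTime T N (Fin.last N) = endTime T := by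
  have hN' : (N : ℝ≥0) ≠ 0 := by exact_mod_cast (by lia : N ≠ 0)
  simp [gridTime, endTime, mul_div_cancel₀ T hN']

lemma gridTime_strictMono {T : ℝ≥0} (hT : 0 < T) {N : ℕ} (hN : 1 ≤ N) :
    StrictMono (gridTime T N) := by
  intro j k h
  have hN' : (0 : ℝ≥0) < N := by exact_mod_cast hN
  rw [← Subtype.coe_lt_coe]
  exact mul_lt_mul_of_pos_right (by exact_mod_cast h) (div_pos hT hN')

lemma continuous_gridEval (d : ℕ) (T : ℝ≥0) (N : ℕ) : Continuous (gridEval d T N) :=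
  continuous_pi fun _ => continuous_eval_const _

/-- The random walk on the torus with a given starting point and given increments. -/
noncomputable def walk (d N : ℕ) :
    Torus d × (Fin d → Fin N → AddCircle (2 * Real.pi)) →+ (Fin (N + 1) → Torus d) where
  toFun p k i := p.1 i + ∑ j : Fin N, if j.castSucc < k then p.2 i j else 0
  map_zero' := by ext; simp
  map_add' p q := by
    ext k i
    simp only [Prod.fst_add, Prod.snd_add, Pi.add_apply, ← Finset.sum_filter,
      Finset.sum_add_distrib]
    abel

lemma continuous_walk (d N : ℕ) : Continuous (walk d N) := by
  refine continuous_pi fun k => continuous_pi fun i => ?_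
  change Continuous fun p : Torus d × (Fin d → Fin N → AddCircle (2 * Real.pi)) =>
    p.1 i + ∑ j : Fin N, if j.castSucc < k then p.2 i j else 0
  refine Continuous.add (by fun_prop) (continuous_finsetSum _ fun j _ => ?_)
  split_ifs <;> fun_prop

/-- Telescoping, in the indicator form used by `walk`: raising k by one adds a single term. -/
lemma sum_increments {A : Type*} [AddCommGroup A] {N : ℕ} (f : Fin (N + 1) → A)
    (k : Fin (N + 1)) :
    ∑ j : Fin N, (if j.castSucc < k then f j.succ - f j.castSucc else 0) = f k - f 0 := by
  induction k using Fin.induction with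
  | zero => simp
  | succ k ih =>
    have h : ∀ j : Fin N, (if j.castSucc < k.succ then f j.succ - f j.castSucc else 0) =
        (if j.castSucc < k.castSucc then f j.succ - f j.castSucc else 0) +
          if j = k then f j.succ - f j.castSucc else 0 := by
      intro j
      rcases lt_trichotomy j k with h | rfl | h
      · have h1 : j.castSucc < k.succ := by simp only [Fin.lt_def, Fin.val_castSucc, Fin.val_succ] at h ⊢; lia
        simp [h1, h, h.ne]
      · simp
      · have h1 : ¬ j.castSucc < k.succ := by simp only [Fin.lt_def, Fin.val_castSucc, Fin.val_succ] at h ⊢; lia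
        simp [h1, h.not_gt, h.ne']
    simp_rw [h]
    rw [Finset.sum_add_distrib, ih]
    simp

/-- This right inverse gives surjectivity of `walk`, and lets the grid values of a path be rewritten
as a walk. -/
lemma walk_increments {d N : ℕ} (x : Fin (N + 1) → Torus d) :
    walk d N (x 0, fun i j => x j.succ i - x j.castSucc i) = x := by
  ext k i
  change x 0 i + ∑ j : Fin N, (if j.castSucc < k then x j.succ i - x j.castSucc i else 0) = _
  rw [sum_increments fun k => x k i]
  abel

/-- A continuous surjective homomorphism of compact groups carries normalized Haar measure to
normalized Haar measure. -/
lemma walk_map_haar (d N : ℕ) :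
    ((leb d).prod (Measure.pi fun _ : Fin d => Measure.pi fun _ : Fin N =>
      (AddCircle.haarAddCircle : Measure (AddCircle (2 * Real.pi))))).map (walk d N) =
      Measure.pi fun _ : Fin (N + 1) => leb d := by
  have : (leb d).IsAddHaarMeasure := by unfold leb; infer_instance
  have h1 : (Measure.pi fun _ : Fin (N + 1) => leb d).IsAddHaarMeasure :=
    Measure.pi.isAddHaarMeasure _
  have h2 : (Measure.pi fun _ : Fin d => Measure.pi fun _ : Fin N =>
      (AddCircle.haarAddCircle : Measure (AddCircle (2 * Real.pi)))).IsAddHaarMeasure :=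
    Measure.pi.isAddHaarMeasure _
  have h3 := Measure.prod.instIsAddHaarMeasure (leb d) (Measure.pi fun _ : Fin d =>
    Measure.pi fun _ : Fin N => (AddCircle.haarAddCircle : Measure (AddCircle (2 * Real.pi))))
  exact (AddMonoidHom.measurePreserving (continuous_walk d N)
    (fun x => ⟨_, walk_increments x⟩) (by simp)).map_eq

/-- On the time grid, the reference process is a random walk with wrapped Gaussian increments. -/
lemma refGridLaw_eq_map_walk (d : ℕ) {T : ℝ≥0} (hT : 0 < T) {N : ℕ} (hN : 1 ≤ N) (ε : ℝ) :
    refGridLaw d T N ε = ((leb d).prod (Measure.pi fun _ : Fin d => Measure.pi fun j : Fin N =>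
      wrappedGaussian (NNReal.mk (√ε ^ 2) (sq_nonneg _) *
        nndist (gridTime T N j.succ).1 (gridTime T N j.castSucc).1))).map (walk d N) := by
  set W : C(Set.Icc (0 : ℝ≥0) T, ℝ) → Fin N → AddCircle (2 * Real.pi) := fun ω j =>
    ((√ε * (ω (gridTime T N j.succ) - ω (gridTime T N j.castSucc)) : ℝ) :
      AddCircle (2 * Real.pi)) with hW
  have hmk : Continuous ((↑) : ℝ → AddCircle (2 * Real.pi)) := AddCircle.continuous_mk' _
  have hWc : Continuous W := continuous_pi fun j => hmk.comp
    (((continuous_eval_const _).sub (continuous_eval_const _)).const_mul _)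
  -- Scaling by √ε and wrapping act coordinatewise, so independence of the increments is preserved.
  have h1 : (wienerMeasure T).map W = Measure.pi fun j : Fin N =>
      wrappedGaussian (NNReal.mk (√ε ^ 2) (sq_nonneg _) *
        nndist (gridTime T N j.succ).1 (gridTime T N j.castSucc).1) := by
    have e : W = (fun z (j : Fin N) => ((√ε * z j : ℝ) : AddCircle (2 * Real.pi))) ∘
      fun ω (j : Fin N) => ω (gridTime T N j.succ) - ω (gridTime T N j.castSucc) := rfl
    have hf : Measurable fun z : ℝ => ((√ε * z : ℝ) : AddCircle (2 * Real.pi)) :=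
      (hmk.comp (continuous_const_mul _)).measurable
    have hg : Continuous fun (ω : C(Set.Icc (0 : ℝ≥0) T, ℝ)) (j : Fin N) =>
        ω (gridTime T N j.succ) - ω (gridTime T N j.castSucc) :=
      continuous_pi fun j => (continuous_eval_const _).sub (continuous_eval_const _)
    have hF : Measurable fun (z : Fin N → ℝ) j => ((√ε * z j : ℝ) : AddCircle (2 * Real.pi)) :=
      measurable_pi_lambda _ fun j => hf.comp (measurable_pi_apply j)
    rw [e, ← Measure.map_map hF hg.measurable,
      wienerMeasure_map_increments T (gridTime_strictMono hT hN).monotone]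
    have (v : ℝ≥0) : IsProbabilityMeasure ((gaussianReal 0 v).map
        fun z : ℝ => ((√ε * z : ℝ) : AddCircle (2 * Real.pi))) :=
      Measure.isProbabilityMeasure_map hf.aemeasurable
    rw [Measure.pi_map_pi fun _ => hf.aemeasurable]
    congr 1
    ext1 j
    have hmul := gaussianReal_map_const_mul (μ := 0)
      (v := nndist (gridTime T N j.succ).1 (gridTime T N j.castSucc).1) √ε
    rw [mul_zero] at hmul
    rw [wrappedGaussian, ← hmul, Measure.map_map hmk.measurable (by fun_prop)]
    rfl
  have : IsProbabilityMeasure ((wienerMeasure T).map W) :=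
    Measure.isProbabilityMeasure_map hWc.measurable.aemeasurable
  have hpi : Measurable fun (w : Fin d → C(Set.Icc (0 : ℝ≥0) T, ℝ)) i => W (w i) :=
    Continuous.measurable (continuous_pi fun i => hWc.comp (continuous_apply i))
  have h2 : (Measure.pi fun _ : Fin d => Measure.pi fun j : Fin N =>
      wrappedGaussian (NNReal.mk (√ε ^ 2) (sq_nonneg _) *
        nndist (gridTime T N j.succ).1 (gridTime T N j.castSucc).1)) =
      (Measure.pi fun _ : Fin d => wienerMeasure T).map fun w i => W (w i) := by
    rw [Measure.pi_map_pi fun _ => hWc.measurable.aemeasurable, h1]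
  rw [h2]
  conv_rhs => rw [← Measure.map_id (μ := leb d)]
  rw [Measure.map_prod_map _ _ measurable_id hpi,
    Measure.map_map (continuous_walk d N).measurable (measurable_id.prodMap hpi), refGridLaw,
    refLaw, Measure.map_map (continuous_gridEval d T N).measurable
      (continuous_brownianPath ε).measurable]
  -- The two maps agree only on paths with B(0) = 0, which is an almost sure event. There the grid
  -- values are the walk from x with the wrapped increments of √ε B, x cancelling in each
  -- difference.
  refine Measure.map_congr ?_
  have h0 : ∀ᵐ w ∂(Measure.pi fun _ : Fin d => wienerMeasure T), ∀ i, w i (startTime T) = 0 :=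
    ae_all_iff.2 fun i => (measurePreserving_eval (fun _ : Fin d => wienerMeasure T) i
      ).quasiMeasurePreserving.ae (ae_eval_startTime_wienerMeasure T)
  filter_upwards [Measure.quasiMeasurePreserving_snd.ae h0] with p hp
  change _ = walk d N (p.1, fun i => W (p.2 i))
  rw [← walk_increments ((gridEval d T N ∘ brownianPath ε) p)]
  congr 2
  · ext i
    change p.1 i + ((√ε * p.2 i (gridTime T N 0) : ℝ) : AddCircle (2 * Real.pi)) = _
    rw [gridTime_zero, hp]
    simp
  · ext i j
    change (p.1 i + ((√ε * p.2 i (gridTime T N j.succ) : ℝ) : AddCircle (2 * Real.pi))) -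
      (p.1 i + ((√ε * p.2 i (gridTime T N j.castSucc) : ℝ) : AddCircle (2 * Real.pi))) =
      ((√ε * (p.2 i (gridTime T N j.succ) - p.2 i (gridTime T N j.castSucc)) : ℝ) :
        AddCircle (2 * Real.pi))
    rw [add_sub_add_left_eq_sub, ← AddCircle.coe_sub, mul_sub]

/-- The law of the reference process on the time grid dominates the Lebesgue measure. -/
lemma exists_pi_leb_le_refGridLaw (d : ℕ) {T : ℝ≥0} (hT : 0 < T) {N : ℕ} (hN : 1 ≤ N) {ε : ℝ}
    (hε : 0 < ε) :
    ∃ C : ℝ≥0, Measure.pi (fun _ : Fin (N + 1) => leb d) ≤ C • refGridLaw d T N ε := by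
  have hv : ∀ j : Fin N, NNReal.mk (√ε ^ 2) (sq_nonneg _) *
      nndist (gridTime T N j.succ).1 (gridTime T N j.castSucc).1 ≠ 0 := by
    intro j
    refine mul_ne_zero (fun h => ?_) (nndist_eq_zero.not.2 fun h => ?_)
    · have := congrArg NNReal.toReal h
      change √ε ^ 2 = 0 at this
      rw [Real.sq_sqrt hε.le] at this
      exact hε.ne' this
    · exact (gridTime_strictMono hT hN (Fin.castSucc_lt_succ (i := j))).ne' (Subtype.ext h)
  choose C hC using fun j => exists_haar_le_wrappedGaussian (hv j)
  -- One constant per coordinate and per time step. Both measures are images under `walk`, so it is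
  -- enough to compare the laws of the increments.
  refine ⟨∏ _ : Fin d, ∏ j, C j, ?_⟩
  rw [← walk_map_haar, refGridLaw_eq_map_walk d hT hN, ← Measure.map_smul]
  refine Measure.map_mono ?_ (continuous_walk d N).measurable
  refine (Measure.prod_mono le_rfl (pi_le_smul_pi fun _ => pi_le_smul_pi hC)).trans (le_of_eq ?_)
  rw [ENNReal.smul_def, Measure.prod_smul_right, ← ENNReal.smul_def]

/-! ### A competitor of finite entropy -/

/-- Replace the first and last entries of `y` by those of `p`. -/
def withEndpoints {X : Type*} (N : ℕ) (q : (X × X) × (Fin (N + 1) → X)) : Fin (N + 1) → X :=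
  fun k => if k = 0 then q.1.1 else if k = Fin.last N then q.1.2 else q.2 k

lemma measurable_withEndpoints {X : Type*} [MeasurableSpace X] (N : ℕ) :
    Measurable (withEndpoints N : (X × X) × (Fin (N + 1) → X) → _) := by
  refine measurable_pi_lambda _ fun k => ?_
  unfold withEndpoints
  split_ifs <;> fun_prop

/-- Resampling two distinct coordinates of an i.i.d. family does not change its law; N ≥ 1 makes the
first and last indices distinct. -/
lemma map_withEndpoints_prod {X : Type*} [MeasurableSpace X] (μ : Measure X)
    [IsProbabilityMeasure μ] {N : ℕ} (hN : 1 ≤ N) :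
    ((μ.prod μ).prod (Measure.pi fun _ : Fin (N + 1) => μ)).map (withEndpoints N) =
      Measure.pi fun _ => μ := by
  refine (Measure.pi_eq fun s hs => ?_).symm
  have hne : Fin.last N ≠ 0 := by simp [Fin.ext_iff]; lia
  rw [Measure.map_apply (measurable_withEndpoints N) (MeasurableSet.univ_pi hs)]
  -- The discarded end entries are unconstrained and contribute factors 1; the fresh endpoints
  -- supply the two missing ones.
  have e : withEndpoints N ⁻¹' Set.univ.pi s = (s 0 ×ˢ s (Fin.last N)) ×ˢ Set.univ.pi fun k =>
      if k = 0 then Set.univ else if k = Fin.last N then Set.univ else s k := by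
    ext q
    simp only [Set.mem_preimage, Set.mem_pi, Set.mem_univ, true_imp_iff, Set.mem_prod,
      withEndpoints]
    constructor
    · intro h
      refine ⟨⟨by simpa using h 0, by simpa [hne] using h (Fin.last N)⟩, fun k => ?_⟩
      have := h k
      split_ifs <;> simp_all
    · rintro ⟨⟨h1, h2⟩, h3⟩ k
      have := h3 k
      split_ifs <;> simp_all
  rw [e, Measure.prod_prod, Measure.prod_prod, Measure.pi_pi]
  rw [← Finset.mul_prod_erase _ _ (Finset.mem_univ (0 : Fin (N + 1))),
    ← Finset.mul_prod_erase _ (fun i => μ (s i)) (Finset.mem_univ (0 : Fin (N + 1))),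
    ← Finset.mul_prod_erase (Finset.univ.erase 0) _
      (Finset.mem_erase.2 ⟨hne, Finset.mem_univ (Fin.last N)⟩),
    ← Finset.mul_prod_erase (Finset.univ.erase 0) (fun i => μ (s i))
      (Finset.mem_erase.2 ⟨hne, Finset.mem_univ (Fin.last N)⟩)]
  simp only [↓reduceIte, measure_univ, one_mul, hne, mul_assoc]
  congr 2
  refine Finset.prod_congr rfl fun k hk => ?_
  simp only [Finset.mem_erase] at hk
  simp [hk.1, hk.2.1]

/-- The plan has endpoints drawn from π and independent uniform intermediate points. It is the image
under `withEndpoints` of π times Leb^(N+1), while Leb^(N+1) is the image of Leb ⊗ Leb times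
Leb^(N+1), so data processing bounds its entropy by that of π. -/
lemma exists_plan_klDiv_ne_top (d : ℕ) {T : ℝ≥0} (hT : 0 < T) {N : ℕ} (hN : 1 ≤ N) {ε : ℝ}
    (hε : 0 < ε) (π : Measure (Torus d × Torus d)) [IsProbabilityMeasure π]
    (hπ₀ : π.map Prod.fst = leb d) (hπ₁ : π.map Prod.snd = leb d)
    (hπent : klDiv π ((leb d).prod (leb d)) < ∞) :
    ∃ γ ∈ Plans d N π, klDiv γ (refGridLaw d T N ε) ≠ ∞ := by
  have hne : Fin.last N ≠ 0 := by simp [Fin.ext_iff]; lia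
  have hm := measurable_withEndpoints (X := Torus d) N
  set μ := π.prod (Measure.pi fun _ : Fin (N + 1) => leb d) with hμ
  have hfst : μ.map Prod.fst = π := by rw [← Measure.fst, hμ, Measure.fst_prod]
  have hsnd : μ.map Prod.snd = Measure.pi fun _ : Fin (N + 1) => leb d := by
    rw [← Measure.snd, hμ, Measure.snd_prod]
  refine ⟨μ.map (withEndpoints N), ⟨Measure.isProbabilityMeasure_map hm.aemeasurable,
    fun k => ?_, ?_⟩, ?_⟩
  · rw [Measure.map_map (measurable_pi_apply k) hm]
    rcases eq_or_ne k 0 with rfl | h0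
    · rw [show ((fun x : Fin (N + 1) → Torus d => x 0) ∘ withEndpoints N) = Prod.fst ∘ Prod.fst from
        funext fun q => by simp [withEndpoints], ← Measure.map_map measurable_fst measurable_fst,
        hfst, hπ₀]
    rcases eq_or_ne k (Fin.last N) with rfl | hl
    · rw [show ((fun x : Fin (N + 1) → Torus d => x (Fin.last N)) ∘ withEndpoints N) =
        Prod.snd ∘ Prod.fst from funext fun q => by simp [withEndpoints, hne],
        ← Measure.map_map measurable_snd measurable_fst, hfst, hπ₁]
    · rw [show ((fun x : Fin (N + 1) → Torus d => x k) ∘ withEndpoints N) =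
        Function.eval k ∘ Prod.snd from funext fun q => by simp [withEndpoints, h0, hl],
        ← Measure.map_map (measurable_pi_apply k) measurable_snd, hsnd]
      exact (measurePreserving_eval (fun _ : Fin (N + 1) => leb d) k).map_eq
  · rw [Measure.map_map (by fun_prop) hm]
    rw [show ((fun x : Fin (N + 1) → Torus d => (x 0, x (Fin.last N))) ∘ withEndpoints N) =
        Prod.fst from funext fun q => by simp [withEndpoints, hne], hfst]
  · obtain ⟨C, hC⟩ := exists_pi_leb_le_refGridLaw d hT hN hε
    have : IsProbabilityMeasure (refGridLaw d T N ε) :=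
      Measure.isProbabilityMeasure_map (continuous_gridEval d T N).measurable.aemeasurable
    have : IsProbabilityMeasure (μ.map (withEndpoints N)) :=
      Measure.isProbabilityMeasure_map hm.aemeasurable
    refine klDiv_ne_top_of_le_smul hC (ne_top_of_le_ne_top hπent.ne ?_)
    rw [← map_withEndpoints_prod (leb d) hN]
    refine (klDiv_map_le _ _ hm).trans (le_of_eq ?_)
    -- The two products share their second factor, which adds no entropy.
    rw [hμ, ← Measure.compProd_const, ← Measure.compProd_const, klDiv_compProd_left]

/-- Each constraint reads a path at grid times only; N ≥ 1 makes T the last of them. -/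
lemma mem_GIF_iff (d : ℕ) (T : ℝ≥0) {N : ℕ} (hN : 1 ≤ N) (π : Measure (Torus d × Torus d))
    (Q : Measure (PathSpace d T)) [IsProbabilityMeasure Q] :
    Q ∈ GIF d T N π ↔ Q.map (gridEval d T N) ∈ Plans d N π := by
  have hm := (continuous_gridEval d T N).measurable
  have : IsProbabilityMeasure (Q.map (gridEval d T N)) :=
    Measure.isProbabilityMeasure_map hm.aemeasurable
  unfold GIF Plans
  simp only [Set.mem_ofPred_eq]
  refine and_congr (iff_of_true ‹_› ‹_›) (and_congr (forall_congr' fun k => ?_) ?_)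
  · rw [Measure.map_map (measurable_pi_apply k) hm]
    rfl
  · rw [Measure.map_map (by fun_prop) hm, ← gridTime_zero T N, ← gridTime_last T hN]
    rfl

end Bredinger

theorem proposition4p1 (d N : ℕ) (hN : 1 ≤ N) (T : ℝ≥0) (hT : 0 < T) (ε : ℝ) (hε : 0 < ε)
    (π : Measure (Bredinger.Torus d × Bredinger.Torus d)) [IsProbabilityMeasure π]
    (hπ₀ : π.map Prod.fst = Bredinger.leb d) (hπ₁ : π.map Prod.snd = Bredinger.leb d)
    (hπent : InformationTheory.klDiv π ((Bredinger.leb d).prod (Bredinger.leb d)) < ∞)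
    (κ : Kernel (Fin (N + 1) → Bredinger.Torus d) (Bredinger.PathSpace d T)) [IsMarkovKernel κ]
    (hκ : Bredinger.IsBrownianBridge d T N ε κ)
    (Q : Measure (Bredinger.PathSpace d T)) (hQ : Q ∈ Bredinger.GIF d T N π) :
    Bredinger.SolvesEntropyMin (Bredinger.GIF d T N π) (Bredinger.refLaw d T ε) Q ↔
      Bredinger.SolvesEntropyMin (Bredinger.Plans d N π) (Bredinger.refGridLaw d T N ε)
          (Q.map (Bredinger.gridEval d T N)) ∧
        Q = (Q.map (Bredinger.gridEval d T N)).bind κ :=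
  Bredinger.solvesEntropyMin_iff_of_disintegration
    (Bredinger.continuous_gridEval d T N).measurable hκ (fun _ h => h.1) (fun _ h => h.1)
    (fun q _ => Bredinger.mem_GIF_iff d T hN π q)
    (Bredinger.exists_plan_klDiv_ne_top d hT hN hε π hπ₀ hπ₁ hπent) hQ
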